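/- Conventions. For a topological group $K$, $K_0$ denotes its identity component. For a compact Lie group $G$ put $A_G = C_G([G_0,G_0])$. A closed subgroup $H$ of $G$ is called *Lie primitive* in $G$ if $(A_G)_0\subset H$ and there is no closed subgroup $K$ of $G$ with $H\subset K\subset G$, $K_0\neq G_0$ and $H_0$ a proper normal subgroup of $K_0$. A closed subgroup $H$ of $G$ is called *quasi-primitive* in $G$ if there is a finite sequence of closed subgroups $G=L_0\supset L_1\supset\dots\supset L_s=H$ such that each $L_{i+1}$ is Lie primitive in $L_i$. A *Cartan subgroup* of $G$ is a maximal torus, that is, a maximal closed connected abelian subgroup. **Theorem.** Let $G$ be a compact Lie group with $G_0\neq 1$ and let $S$ be a closed subgroup of $G$. Then there is a quasi-primitive closed subgroup $H$ of $G$ with $S\subset H$ and $H_0\neq 1$ such that at least one of the following holds: 1. $H_0$ is a Cartan subgroup of $G$; 2. $H_0$ is not abelian, and $SA_H/A_H$ is Lie primitive in $H/A_H$. -/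

import Mathlib

open scoped Manifold ContDiff

namespace CompactLie

variable {G : Type*} [Group G] [TopologicalSpace G] [IsTopologicalGroup G]

/-- The identity component `H₀` of a subgroup `H` (with the subspace topology), as a subgroup of
the ambient group. -/
def identityComponent (H : Subgroup G) : Subgroup G :=
  (Subgroup.connectedComponentOfOne H).map H.subtype

variable (G) in
/-- The abelian part `A_G = C_G([G₀, G₀])` of `G`. -/
def abelianPart : Subgroup G :=
  Subgroup.centralizer
    (⁅Subgroup.connectedComponentOfOne G, Subgroup.connectedComponentOfOne G⁆ : Subgroup G)

theorem connectedComponentOfOne_normal : (Subgroup.connectedComponentOfOne G).Normal := by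
  refine ⟨fun n hn g => ?_⟩
  have hc : Continuous fun x : G => g * x * g⁻¹ := by fun_prop
  have h := hc.mapsTo_connectedComponent (1 : G)
  have h' := h hn
  simpa [Subgroup.connectedComponentOfOne] using h'

instance abelianPart_normal : (abelianPart G).Normal := by
  have := connectedComponentOfOne_normal (G := G)
  unfold abelianPart
  infer_instance

/-- A closed subgroup `H` of `G` is Lie primitive if `(A_G)₀ ⊆ H` and there is no closed subgroup
`K` with `H ⊆ K ⊆ G` and `K₀ ≠ G₀` such that `H₀` is a proper normal subgroup of `K₀`. -/
def IsLiePrimitive (H : Subgroup G) : Prop :=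
  IsClosed (H : Set G) ∧
  identityComponent (abelianPart G) ≤ H ∧
  ¬ ∃ K : Subgroup G, IsClosed (K : Set G) ∧ H ≤ K ∧
      identityComponent K ≠ Subgroup.connectedComponentOfOne G ∧
      identityComponent H < identityComponent K ∧
      ((identityComponent H).subgroupOf (identityComponent K)).Normal

/-- `H` is quasi-primitive in `G` if there is a finite sequence of subgroups
`G = L₀ ⊇ L₁ ⊇ ⋯ ⊇ L_s = H`, each of which is a Lie primitive closed subgroup of the previous one.
(Being closed in the previous term, each term is closed in `G`.) -/
def IsQuasiPrimitive (H : Subgroup G) : Prop :=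
  Relation.ReflTransGen
    (fun L L' : Subgroup G => L' ≤ L ∧ IsLiePrimitive (L'.subgroupOf L)) ⊤ H

/-- A Cartan subgroup of a compact Lie group in the sense of a maximal torus: a maximal element
among the closed connected abelian subgroups. -/
def IsCartanSubgroup (T : Subgroup G) : Prop :=
  Maximal (fun T : Subgroup G =>
    IsClosed (T : Set G) ∧ IsConnected (T : Set G) ∧ IsMulCommutative T) T

/-- The image `S A_H / A_H` of a subgroup `S ≤ H` in `H / A_H`. -/
def imageModAbelianPart (S H : Subgroup G) : Subgroup (H ⧸ abelianPart H) :=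
  (S.subgroupOf H).map (QuotientGroup.mk' (abelianPart H))

end CompactLie

namespace CompactLie

open Set Topology

/-! The proof is a double descent on dimension. Among the closed quasi-primitive M ⊇ S with M₀ ≠ 1
whose maximal tori are all maximal in G, take one of least dimension. If M₀ is abelian, it is itself
a maximal torus. Otherwise take H ⊆ M of least dimension among the closed quasi-primitive subgroups
containing S with nonabelian identity component. If S A_H / A_H is not Lie primitive in H/A_H, there
is a closed L with S ⊆ L ⊆ H, L Lie primitive in H, L₀ ≠ H₀ and L₀ ⊄ A_H
(`exists_isLiePrimitive_of_not_isLiePrimitive_image`).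

Minimality of H makes T = L₀ a torus. Then N = M ∩ N(T) contains S, is Lie primitive in M
(`isLiePrimitive_inf_normalizer`) and keeps full rank (`HasFullRank.inf_normalizer`). It has smaller
dimension than M: otherwise M₀ would centralize T, and T would lie in A_H. This contradicts
minimality of M.

The Lie theory needed is that dimension increases strictly along closed connected subgroups, that
identity components of closed subgroups are open in them, and that a connected group normalizing an
abelian one centralizes it. All three come from coordinates in which multiplication is addition to
first order; no exponential map or Lie bracket is used. -/

/-- Logarithmic coordinates near the identity of a topological group: multiplication agrees with
addition to first order. -/
structure LocalLog (G E : Type*) [Group G] [TopologicalSpace G] [NormedAddCommGroup E] where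
  /-- the coordinate map -/
  toFun : G → E
  /-- the coordinate neighbourhood -/
  dom : Set G
  dom_mem : dom ∈ 𝓝 1
  map_one : toFun 1 = 0
  continuousAt : ContinuousAt toFun 1
  basis : ∀ U ∈ 𝓝 (1 : G), ∃ r > 0, ∀ x ∈ dom, ‖toFun x‖ < r → x ∈ U
  mul : ∀ ε > 0, ∃ r > 0, ∀ x ∈ dom, ∀ y ∈ dom, ‖toFun x‖ < r → ‖toFun y‖ < r →
    x * y ∈ dom ∧ ‖toFun (x * y) - toFun x - toFun y‖ ≤ ε * ‖toFun y‖

/-! ### First-order calculus and tangent spaces of subgroups -/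

namespace LocalLog

variable {G E : Type*} [Group G] [TopologicalSpace G] [NormedAddCommGroup E]

/-- Restriction of logarithmic coordinates to a subgroup. -/
def restrict (Φ : LocalLog G E) (A : Subgroup G) : LocalLog A E where
  toFun x := Φ.toFun x
  dom := {x | (x : G) ∈ Φ.dom}
  dom_mem := continuous_subtype_val.continuousAt.preimage_mem_nhds Φ.dom_mem
  map_one := Φ.map_one
  continuousAt :=
    ContinuousAt.comp (g := Φ.toFun) (f := ((↑) : A → G)) Φ.continuousAt
      continuous_subtype_val.continuousAt
  basis U hU := by
    obtain ⟨V, hV, hVU⟩ := mem_nhds_subtype _ _ _ |>.1 hU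
    obtain ⟨r, hr, h⟩ := Φ.basis V hV
    exact ⟨r, hr, fun x hx hxr => hVU (h x hx hxr)⟩
  mul ε hε := by
    obtain ⟨r, hr, h⟩ := Φ.mul ε hε
    exact ⟨r, hr, fun x hx y hy hxr hyr => h x hx y hy hxr hyr⟩

variable (Φ : LocalLog G E)

theorem one_mem_dom : (1 : G) ∈ Φ.dom := mem_of_mem_nhds Φ.dom_mem

theorem ball_mem_nhds {r : ℝ} (hr : 0 < r) : {x | x ∈ Φ.dom ∧ ‖Φ.toFun x‖ < r} ∈ 𝓝 (1 : G) := by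
  have h : ∀ᶠ x in 𝓝 (1 : G), ‖Φ.toFun x‖ < r := by
    have := Φ.continuousAt.norm
    refine this.eventually_lt continuousAt_const ?_
    simpa [Φ.map_one] using hr
  exact Filter.inter_mem Φ.dom_mem h

theorem eq_one_of_map_eq_zero [T2Space G] {x : G} (hx : x ∈ Φ.dom) (h : Φ.toFun x = 0) :
    x = 1 := by
  by_contra hne
  obtain ⟨r, hr, H⟩ := Φ.basis {x}ᶜ (isOpen_compl_singleton.mem_nhds (by simpa using Ne.symm hne))
  exact H x hx (by simpa [h] using hr) rfl

theorem inv [IsTopologicalGroup G] {ε : ℝ} (hε : 0 < ε) : ∃ r > 0, ∀ x ∈ Φ.dom, ‖Φ.toFun x‖ < r →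
    x⁻¹ ∈ Φ.dom ∧ ‖Φ.toFun x⁻¹‖ < ε ∧ ‖Φ.toFun x⁻¹ + Φ.toFun x‖ ≤ ε * ‖Φ.toFun x‖ := by
  obtain ⟨r₁, hr₁, h₁⟩ := Φ.mul ε hε
  have hm : (fun x : G => x⁻¹) ⁻¹' {x | x ∈ Φ.dom ∧ ‖Φ.toFun x‖ < min r₁ ε} ∈ 𝓝 (1 : G) := by
    refine continuous_inv.continuousAt.preimage_mem_nhds ?_
    rw [inv_one]
    exact Φ.ball_mem_nhds (lt_min hr₁ hε)
  obtain ⟨r₂, hr₂, h₂⟩ := Φ.basis _ hm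
  refine ⟨min r₁ r₂, lt_min hr₁ hr₂, fun x hx hxr => ?_⟩
  obtain ⟨hd, hn⟩ := h₂ x hx (hxr.trans_le (min_le_right _ _))
  refine ⟨hd, hn.trans_le (min_le_right _ _), ?_⟩
  have := (h₁ x⁻¹ hd x hx (hn.trans_le (min_le_left _ _)) (hxr.trans_le (min_le_left _ _))).2
  rw [inv_mul_cancel, Φ.map_one, zero_sub, ← norm_neg] at this
  simpa [add_comm] using this

variable [NormedSpace ℝ E]

theorem pow {ε : ℝ} (hε : 0 < ε) : ∃ r > 0, ∀ a ∈ Φ.dom, ∀ k : ℕ, k * ‖Φ.toFun a‖ < r →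
    a ^ k ∈ Φ.dom ∧ ‖Φ.toFun (a ^ k) - (k : ℝ) • Φ.toFun a‖ ≤ ε * (k * ‖Φ.toFun a‖) := by
  obtain ⟨r, hr, h⟩ := Φ.mul ε hε
  refine ⟨r / (1 + ε), by positivity, fun a ha k => ?_⟩
  induction k with
  | zero => intro _; simp [Φ.one_mem_dom, Φ.map_one]
  | succ k ih =>
    intro hk
    have hna := norm_nonneg (Φ.toFun a)
    rw [lt_div_iff₀ (by positivity)] at hk
    push_cast at hk
    have hkn : 0 ≤ k * ‖Φ.toFun a‖ := by positivity
    obtain ⟨hd, he⟩ := ih (by rw [lt_div_iff₀ (by positivity)]; nlinarith)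
    have hnk : ‖Φ.toFun (a ^ k)‖ < r := by
      have h1 : ‖Φ.toFun (a ^ k)‖ ≤ ‖Φ.toFun (a ^ k) - (k : ℝ) • Φ.toFun a‖ +
          ‖(k : ℝ) • Φ.toFun a‖ := norm_le_norm_sub_add _ _
      rw [norm_smul, Real.norm_natCast] at h1
      nlinarith
    obtain ⟨hd', he'⟩ := h _ hd a ha hnk (by nlinarith)
    rw [pow_succ]
    refine ⟨hd', ?_⟩
    have : Φ.toFun (a ^ k * a) - ((k + 1 : ℕ) : ℝ) • Φ.toFun a =
        (Φ.toFun (a ^ k * a) - Φ.toFun (a ^ k) - Φ.toFun a) +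
        (Φ.toFun (a ^ k) - (k : ℝ) • Φ.toFun a) := by
      push_cast; rw [add_smul, one_smul]; abel
    rw [this]
    refine (norm_add_le _ _).trans ?_
    push_cast
    nlinarith

/-- There are no small subgroups. -/
theorem exists_nhds_no_subgroup (Φ : LocalLog G E) [T2Space G] :
    ∃ U ∈ 𝓝 (1 : G), ∀ Γ : Subgroup G, (Γ : Set G) ⊆ U → Γ = ⊥ := by
  obtain ⟨r, hr, h⟩ := Φ.pow (ε := 1 / 2) (by norm_num)
  refine ⟨_, Φ.ball_mem_nhds (r := r / 8) (by positivity), fun Γ hΓ => ?_⟩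
  rw [Subgroup.eq_bot_iff_forall]
  intro x hx
  obtain ⟨hd, hn⟩ := hΓ hx
  by_contra hne
  have h0 : 0 < ‖Φ.toFun x‖ := by
    rw [norm_pos_iff]
    exact fun h0 => hne (Φ.eq_one_of_map_eq_zero hd h0)
  -- The largest multiple of ‖log x‖ not exceeding r/2 is more than 3r/8, so the coordinate of x ^ k
  -- has norm above 3r/16, outside the r/8-ball.
  set k := ⌊r / 2 / ‖Φ.toFun x‖⌋₊
  have hk1 : k * ‖Φ.toFun x‖ ≤ r / 2 := by
    rw [← le_div_iff₀ h0]; exact Nat.floor_le (by positivity)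
  have hk2 : r / 2 < (k + 1) * ‖Φ.toFun x‖ := by
    rw [← div_lt_iff₀ h0]; exact Nat.lt_floor_add_one _
  obtain ⟨-, hp⟩ := h x hd k (by linarith)
  obtain ⟨-, hs⟩ := hΓ (Γ.pow_mem hx k)
  have h1 : ‖(k : ℝ) • Φ.toFun x‖ ≤ ‖(k : ℝ) • Φ.toFun x - Φ.toFun (x ^ k)‖ +
      ‖Φ.toFun (x ^ k)‖ := norm_le_norm_sub_add _ _
  rw [norm_smul, Real.norm_natCast, norm_sub_rev] at h1
  nlinarith

/-- The tangent space at the identity of a subgroup. -/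
def tangent [IsTopologicalGroup G] (A : Subgroup G) : Submodule ℝ E where
  -- Asking for an approximant at every small t, not just along a sequence, is what gives closure
  -- under addition: approximants of v and w at the same t can be multiplied.
  carrier := {v | ∀ ε > 0, ∃ δ > 0, ∀ t, 0 < t → t < δ →
    ∃ a ∈ A, a ∈ Φ.dom ∧ ‖Φ.toFun a - t • v‖ ≤ ε * t}
  zero_mem' := fun ε hε => ⟨1, one_pos, fun t ht _ =>
    ⟨1, A.one_mem, Φ.one_mem_dom, by simpa [Φ.map_one] using by positivity⟩⟩
  add_mem' := by
    intro v w hv hw ε hε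
    set η := min 1 (ε / (3 + ‖w‖)) with hη
    have hη0 : 0 < η := by positivity
    have hη1 : η ≤ 1 := min_le_left _ _
    have hη2 : η * (3 + ‖w‖) ≤ ε := by
      rw [← le_div_iff₀ (by positivity)]; exact min_le_right _ _
    obtain ⟨r, hr, hm⟩ := Φ.mul η hη0
    obtain ⟨δ₁, hδ₁, h₁⟩ := hv η hη0
    obtain ⟨δ₂, hδ₂, h₂⟩ := hw η hη0
    refine ⟨min (min δ₁ δ₂) (r / (1 + ‖v‖ + ‖w‖)), by positivity, fun t ht htδ => ?_⟩
    simp only [lt_min_iff] at htδ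
    obtain ⟨⟨ht1, ht2⟩, ht3⟩ := htδ
    rw [lt_div_iff₀ (by positivity)] at ht3
    obtain ⟨a, haA, had, ha⟩ := h₁ t ht ht1
    obtain ⟨b, hbA, hbd, hb⟩ := h₂ t ht ht2
    have hna : ‖Φ.toFun a‖ ≤ t * (1 + ‖v‖) := by
      have := norm_le_norm_sub_add (Φ.toFun a) (t • v)
      rw [norm_smul, Real.norm_of_nonneg ht.le] at this
      nlinarith
    have hnb : ‖Φ.toFun b‖ ≤ t * (1 + ‖w‖) := by
      have := norm_le_norm_sub_add (Φ.toFun b) (t • w)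
      rw [norm_smul, Real.norm_of_nonneg ht.le] at this
      nlinarith
    have hvn := mul_nonneg ht.le (norm_nonneg v)
    have hwn := mul_nonneg ht.le (norm_nonneg w)
    obtain ⟨hd, he⟩ := hm a had b hbd (by nlinarith) (by nlinarith)
    refine ⟨a * b, A.mul_mem haA hbA, hd, ?_⟩
    have : Φ.toFun (a * b) - t • (v + w) = (Φ.toFun (a * b) - Φ.toFun a - Φ.toFun b) +
        (Φ.toFun a - t • v) + (Φ.toFun b - t • w) := by rw [smul_add]; abel
    rw [this]
    refine (norm_add₃_le).trans ?_
    nlinarith [mul_le_mul_of_nonneg_left hnb hη0.le, mul_le_mul_of_nonneg_right hη2 ht.le]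
  smul_mem' := by
    have pos : ∀ c : ℝ, 0 < c → ∀ v : E, (∀ ε > 0, ∃ δ > 0, ∀ t, 0 < t → t < δ →
        ∃ a ∈ A, a ∈ Φ.dom ∧ ‖Φ.toFun a - t • v‖ ≤ ε * t) → (∀ ε > 0, ∃ δ > 0, ∀ t, 0 < t → t < δ →
        ∃ a ∈ A, a ∈ Φ.dom ∧ ‖Φ.toFun a - t • (c • v)‖ ≤ ε * t) := by
      intro c hc v hv ε hε
      obtain ⟨δ, hδ, h⟩ := hv (ε / c) (by positivity)
      refine ⟨δ / c, by positivity, fun t ht htδ => ?_⟩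
      obtain ⟨a, haA, had, ha⟩ := h (t * c) (by positivity) (by rwa [lt_div_iff₀ hc] at htδ)
      refine ⟨a, haA, had, ?_⟩
      rw [smul_smul]
      refine ha.trans (le_of_eq ?_)
      field_simp
    have neg : ∀ v : E, (∀ ε > 0, ∃ δ > 0, ∀ t, 0 < t → t < δ →
        ∃ a ∈ A, a ∈ Φ.dom ∧ ‖Φ.toFun a - t • v‖ ≤ ε * t) → (∀ ε > 0, ∃ δ > 0, ∀ t, 0 < t → t < δ →
        ∃ a ∈ A, a ∈ Φ.dom ∧ ‖Φ.toFun a - t • (-v)‖ ≤ ε * t) := by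
      intro v hv ε hε
      set η := min 1 (ε / (2 + ‖v‖)) with hη
      have hη0 : 0 < η := by positivity
      have hη1 : η ≤ 1 := min_le_left _ _
      have hη2 : η * (2 + ‖v‖) ≤ ε := by
        rw [← le_div_iff₀ (by positivity)]; exact min_le_right _ _
      obtain ⟨r, hr, hi⟩ := Φ.inv hη0
      obtain ⟨δ, hδ, h⟩ := hv η hη0
      refine ⟨min δ (r / (1 + ‖v‖)), by positivity, fun t ht htδ => ?_⟩
      simp only [lt_min_iff] at htδ
      obtain ⟨ht1, ht3⟩ := htδ
      rw [lt_div_iff₀ (by positivity)] at ht3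
      obtain ⟨a, haA, had, ha⟩ := h t ht ht1
      have hna : ‖Φ.toFun a‖ ≤ t * (1 + ‖v‖) := by
        have := norm_le_norm_sub_add (Φ.toFun a) (t • v)
        rw [norm_smul, Real.norm_of_nonneg ht.le] at this
        nlinarith
      obtain ⟨hd, -, he⟩ := hi a had (by linarith)
      refine ⟨a⁻¹, A.inv_mem haA, hd, ?_⟩
      have : Φ.toFun a⁻¹ - t • (-v) = (Φ.toFun a⁻¹ + Φ.toFun a) - (Φ.toFun a - t • v) := by
        rw [smul_neg]; abel
      rw [this]
      refine (norm_sub_le _ _).trans ?_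
      nlinarith [mul_le_mul_of_nonneg_left hna hη0.le, mul_le_mul_of_nonneg_right hη2 ht.le]
    intro c v hv
    rcases lt_trichotomy c 0 with hc | rfl | hc
    · have := pos (-c) (by linarith) _ (neg v hv)
      simpa using this
    · intro ε hε
      exact ⟨1, one_pos, fun t ht _ =>
        ⟨1, A.one_mem, Φ.one_mem_dom, by simpa [Φ.map_one] using by positivity⟩⟩
    · exact pos c hc v hv

theorem tangent_mono [IsTopologicalGroup G] {A B : Subgroup G} (h : A ≤ B) :
    Φ.tangent A ≤ Φ.tangent B := fun _ hv ε hε =>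
  let ⟨δ, hδ, H⟩ := hv ε hε
  ⟨δ, hδ, fun t ht htδ => let ⟨a, ha, h'⟩ := H t ht htδ; ⟨a, h ha, h'⟩⟩

/-- `v` is a limit of directions of elements of `A` tending to the identity. -/
def IsLimitDirection (A : Subgroup G) (v : E) : Prop :=
  ∀ ε > 0, ∀ δ > 0, ∃ a ∈ A, a ∈ Φ.dom ∧ ∃ s : ℝ, 0 < s ∧ s < δ ∧ ‖Φ.toFun a - s • v‖ ≤ ε * s

/-- In a compact group a closed set avoiding the identity component is avoided by all powers of all
elements close to the identity. -/
theorem _root_.CompactLie.exists_nhds_pow_notMem [IsTopologicalGroup G] [CompactSpace G] [T2Space G]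
    {F : Set G} (hF : IsClosed F) (hd : Disjoint F (connectedComponent (1 : G))) :
    ∃ V ∈ 𝓝 (1 : G), ∀ a ∈ V, ∀ k : ℕ, a ^ k ∉ F := by
  have hF' : IsClosed (((↑) : G → ConnectedComponents G) '' F) :=
    (hF.isCompact.image ConnectedComponents.continuous_coe).isClosed
  have h1 : ((1 : G) : ConnectedComponents G) ∈ (((↑) : G → ConnectedComponents G) '' F)ᶜ := by
    rintro ⟨x, hx, he⟩
    rw [ConnectedComponents.coe_eq_coe] at he
    exact Set.disjoint_left.1 hd hx (he ▸ mem_connectedComponent)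
  -- A clopen set Z of components separates 1 from F. Its preimage is compact and open, hence stable
  -- under right multiplication by some neighbourhood V of 1, so powers of elements of V never leave
  -- it.
  obtain ⟨Z, hZ, h1Z, hZF⟩ := compact_exists_isClopen_in_isOpen hF'.isOpen_compl h1
  have hZ' := hZ.preimage ConnectedComponents.continuous_coe
  obtain ⟨V, hV, hZV⟩ := compact_open_separated_mul_right hZ'.isClosed.isCompact hZ'.isOpen
    Subset.rfl
  refine ⟨V, hV, fun a ha k hk => ?_⟩
  have : ∀ k : ℕ, a ^ k ∈ ((↑) : G → ConnectedComponents G) ⁻¹' Z := by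
    intro k
    induction k with
    | zero => simpa using h1Z
    | succ k ih => rw [pow_succ]; exact hZV (Set.mul_mem_mul ih ha)
  exact hZF (this k) ⟨_, hk, rfl⟩

/-- Limit directions, known only along a sequence, become tangent vectors of the identity component.
If that component missed the ε t-ball about t v, powers of elements near 1 would avoid the half-size
ball; but when log a ≈ s v with s tiny, a ^ ⌊t/s⌋ lands in it. -/
theorem exists_mem_connectedComponent [IsTopologicalGroup G] [CompactSpace G] [T2Space G] {v : E}
    (hv : Φ.IsLimitDirection ⊤ v) {ε : ℝ} (hε : 0 < ε) : ∃ δ > 0, ∀ t, 0 < t → t < δ →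
      ∃ a ∈ connectedComponent (1 : G), a ∈ Φ.dom ∧ ‖Φ.toFun a - t • v‖ ≤ ε * t := by
  set η := min 1 (ε / (2 * (4 + 2 * ‖v‖))) with hη
  have hη0 : 0 < η := by positivity
  have hη1 : η ≤ 1 := min_le_left _ _
  have hη2 : η * (4 + 2 * ‖v‖) ≤ ε / 2 := by
    have : η ≤ ε / (2 * (4 + 2 * ‖v‖)) := min_le_right _ _
    rw [le_div_iff₀ (by positivity)] at this
    linarith
  obtain ⟨r₁, hr₁, hm⟩ := Φ.mul 1 one_pos
  obtain ⟨r₂, hr₂, hp⟩ := Φ.pow hη0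
  refine ⟨min r₁ r₂ / (2 + ‖v‖ + ε), by positivity, fun t ht htδ => ?_⟩
  rw [lt_div_iff₀ (by positivity), lt_min_iff] at htδ
  obtain ⟨ht1, ht2⟩ := htδ
  have hvn := norm_nonneg v
  have htv := mul_nonneg ht.le hvn
  by_contra! hcon
  set F : Set G := {x | x ∈ Φ.dom ∧ ‖Φ.toFun x - t • v‖ ≤ ε / 2 * t}
  -- The coordinate is only assumed continuous at 1, so F need not be closed. The slack between ε/2
  -- and ε absorbs the passage to its closure.
  have hdisj : Disjoint (closure F) (connectedComponent (1 : G)) := by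
    rw [Set.disjoint_left]
    intro b hb hb1
    have hU : {x : G | x⁻¹ * b ∈ {y | y ∈ Φ.dom ∧ ‖Φ.toFun y‖ < min r₁ (ε * t / 4)}} ∈ 𝓝 b := by
      have hc : ContinuousAt (fun x : G => x⁻¹ * b) b := by fun_prop
      refine hc.preimage_mem_nhds ?_
      rw [inv_mul_cancel]
      exact Φ.ball_mem_nhds (by positivity)
    obtain ⟨x, ⟨hz, hzr⟩, hxd, hxn⟩ := mem_closure_iff_nhds.1 hb _ hU
    rw [lt_min_iff] at hzr
    have hnx : ‖Φ.toFun x‖ < r₁ := by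
      have := norm_le_norm_sub_add (Φ.toFun x) (t • v)
      rw [norm_smul, Real.norm_of_nonneg ht.le] at this
      nlinarith
    obtain ⟨hbd, hbn⟩ := hm x hxd _ hz hnx hzr.1
    rw [mul_inv_cancel_left] at hbd hbn
    refine (hcon b hb1 hbd).not_ge ?_
    have : Φ.toFun b - t • v = (Φ.toFun b - Φ.toFun x - Φ.toFun (x⁻¹ * b)) +
        (Φ.toFun x - t • v) + Φ.toFun (x⁻¹ * b) := by abel
    rw [this]
    refine (norm_add₃_le).trans ?_
    linarith [hzr.2]
  obtain ⟨V, hV, hVF⟩ := exists_nhds_pow_notMem isClosed_closure hdisj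
  obtain ⟨r₄, hr₄, hb⟩ := Φ.basis V hV
  obtain ⟨a, -, had, s, hs, hsδ, has⟩ := hv η hη0
    (min (min t (r₄ / (1 + ‖v‖))) (η * t)) (by positivity)
  simp only [lt_min_iff] at hsδ
  obtain ⟨⟨hst, hs4⟩, hsη⟩ := hsδ
  rw [lt_div_iff₀ (by positivity)] at hs4
  have hna : ‖Φ.toFun a‖ ≤ s * (1 + ‖v‖) := by
    have := norm_le_norm_sub_add (Φ.toFun a) (s • v)
    rw [norm_smul, Real.norm_of_nonneg hs.le] at this
    nlinarith
  refine hVF a (hb a had (by linarith)) ⌊t / s⌋₊ (subset_closure ?_)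
  set k := ⌊t / s⌋₊
  have hk1 : k * s ≤ t := by
    rw [← le_div_iff₀ hs]; exact Nat.floor_le (by positivity)
  have hk2 : t < (k + 1) * s := by
    rw [← div_lt_iff₀ hs]; exact Nat.lt_floor_add_one _
  have hka : k * ‖Φ.toFun a‖ ≤ t * (1 + ‖v‖) := by
    calc k * ‖Φ.toFun a‖ ≤ k * (s * (1 + ‖v‖)) := by gcongr
      _ = (k * s) * (1 + ‖v‖) := by ring
      _ ≤ _ := by gcongr
  obtain ⟨hd, he⟩ := hp a had k (by nlinarith)
  refine ⟨hd, ?_⟩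
  have : Φ.toFun (a ^ k) - t • v = (Φ.toFun (a ^ k) - (k : ℝ) • Φ.toFun a) +
      (k : ℝ) • (Φ.toFun a - s • v) + (k * s - t) • v := by
    rw [smul_sub, sub_smul, smul_smul]; abel
  rw [this]
  refine (norm_add₃_le).trans ?_
  rw [norm_smul, norm_smul, Real.norm_natCast]
  have h3 : ‖(k * s - t : ℝ)‖ ≤ η * t := by
    rw [Real.norm_of_nonpos (by linarith)]; nlinarith
  have h2 : k * ‖Φ.toFun a - s • v‖ ≤ η * t := by
    calc k * ‖Φ.toFun a - s • v‖ ≤ k * (η * s) := by gcongr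
      _ = η * (k * s) := by ring
      _ ≤ _ := by gcongr
  nlinarith [mul_le_mul_of_nonneg_left hka hη0.le, mul_le_mul_of_nonneg_right hη2 ht.le,
    mul_le_mul_of_nonneg_right h3 hvn]

end LocalLog

/-! ### Coordinates from the chart at the identity -/

/-- Logarithmic coordinates on a Lie group, given by the chart at the identity. -/
theorem nonempty_localLog {E : Type*} [NormedAddCommGroup E] [NormedSpace ℝ E]
    (G : Type*) [Group G] [TopologicalSpace G] [IsTopologicalGroup G]
    [ChartedSpace E G] [LieGroup 𝓘(ℝ, E) ∞ G] : Nonempty (LocalLog G E) := by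
  set φ := extChartAt 𝓘(ℝ, E) (1 : G) with hφ
  set e := φ 1 with he
  set f : E × E → E := fun p => φ (φ.symm p.1 * φ.symm p.2) with hf
  have hsrc : φ.source ∈ 𝓝 (1 : G) := extChartAt_source_mem_nhds 1
  have htgt : φ.target ∈ 𝓝 e := extChartAt_target_mem_nhds 1
  have hsymm : ContinuousAt φ.symm e := continuousAt_extChartAt_symm 1
  have hsymm1 : φ.symm e = 1 := extChartAt_to_inv 1
  have hfd : ContDiffAt ℝ ∞ f (e, e) := by
    have := (contMDiff_mul 𝓘(ℝ, E) ∞ (G := G)) (1, 1)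
    rw [contMDiffAt_iff] at this
    have h2 := this.2
    simp only [mul_one] at h2
    have hr : range (𝓘(ℝ, E).prod 𝓘(ℝ, E)) = univ := by
      rw [← modelWithCornersSelf_prod]; simp
    rw [hr, contDiffWithinAt_univ, extChartAt_prod] at h2
    exact h2
  have hstrict := hfd.hasStrictFDerivAt (by simp)
  set L := fderiv ℝ f (e, e)
  have hL : ∀ w, L (0, w) = w := by
    have hev : (fun w : E => f (e, w)) =ᶠ[𝓝 e] id := by
      filter_upwards [htgt] with w hw
      simp only [hf, hsymm1, one_mul, id]
      exact φ.right_inv hw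
    have h1 : HasFDerivAt (fun w : E => f (e, w)) (L.comp (ContinuousLinearMap.inr ℝ E E)) e :=
      HasFDerivAt.comp (g := f) e hstrict.hasFDerivAt (hasFDerivAt_prodMk_right e e)
    have h2 := h1.unique ((hasFDerivAt_id e).congr_of_eventuallyEq hev)
    intro w
    exact DFunLike.congr_fun h2 w
  have hmulW : ∀ᶠ p : E × E in 𝓝 (e, e), φ.symm p.1 * φ.symm p.2 ∈ φ.source := by
    have hc : ContinuousAt (fun p : E × E => φ.symm p.1 * φ.symm p.2) (e, e) :=
      (ContinuousAt.comp (g := φ.symm) (f := Prod.fst) hsymm continuousAt_fst).mul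
        (ContinuousAt.comp (g := φ.symm) (f := Prod.snd) hsymm continuousAt_snd)
    refine hc.preimage_mem_nhds ?_
    simpa [hsymm1] using hsrc
  refine ⟨⟨fun x => φ x - e, φ.source, hsrc, by simp [he], ?_, ?_, ?_⟩⟩
  · exact (continuousAt_extChartAt 1).sub continuousAt_const
  · intro U hU
    have : φ.symm ⁻¹' U ∈ 𝓝 e := hsymm.preimage_mem_nhds (by rwa [hsymm1])
    obtain ⟨r, hr, h⟩ := Metric.mem_nhds_iff.1 this
    refine ⟨r, hr, fun x hx hxr => ?_⟩
    have := h (show φ x ∈ Metric.ball e r by rwa [mem_ball_iff_norm])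
    simpa [φ.left_inv hx] using this
  · intro ε hε
    have h1 := hstrict.isLittleO.def hε
    rw [nhds_prod_eq] at h1
    obtain ⟨r₁, hr₁, h1⟩ := (Metric.nhds_basis_ball.prod_self.eventually_iff).1 h1
    obtain ⟨r₂, hr₂, h2⟩ := Metric.eventually_nhds_iff.1 hmulW
    refine ⟨min r₁ r₂, lt_min hr₁ hr₂, fun x hx y hy hxr hyr => ?_⟩
    rw [lt_min_iff] at hxr hyr
    have hxy {r : ℝ} (h₁ : ‖φ x - e‖ < r) (h₂ : ‖φ y - e‖ < r) :
        dist (φ x, φ y) (e, e) < r := by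
      rw [Prod.dist_eq, dist_eq_norm, dist_eq_norm]
      exact max_lt h₁ h₂
    have hxe : dist (φ x, e) (e, e) < r₁ := by
      rw [Prod.dist_eq, dist_eq_norm, dist_self]
      exact max_lt hxr.1 hr₁
    have h2' := h2 (hxy hxr.2 hyr.2)
    -- Strict differentiability is applied to two points with the same first coordinate, so the
    -- error is controlled by y alone and only the partial derivative `hL` enters.
    have h1' := h1 (x := ((φ x, φ y), (φ x, e)))
      ⟨Metric.mem_ball.2 (hxy hxr.1 hyr.1), Metric.mem_ball.2 hxe⟩
    simp only [hf, hsymm1, φ.left_inv hx, φ.left_inv hy, mul_one, Prod.mk_sub_mk,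
      sub_self, hL, Prod.norm_mk, norm_zero] at h1' h2'
    refine ⟨h2', ?_⟩
    have : φ (x * y) - e - (φ x - e) - (φ y - e) = φ (x * y) - φ x - (φ y - e) := by abel
    rw [this]
    simpa using h1'

/-! ### Identity components of subgroups -/

section IdentityComponent

variable {G : Type*} [Group G] [TopologicalSpace G] [IsTopologicalGroup G]

theorem coe_identityComponent (H : Subgroup G) :
    (identityComponent H : Set G) = connectedComponentIn (H : Set G) 1 := by
  rw [connectedComponentIn_eq_image H.one_mem]
  rfl

theorem identityComponent_le (H : Subgroup G) : identityComponent H ≤ H := by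
  rintro x ⟨y, -, rfl⟩
  exact y.2

theorem isPreconnected_identityComponent (H : Subgroup G) :
    IsPreconnected (identityComponent H : Set G) := by
  rw [coe_identityComponent]
  exact isPreconnected_connectedComponentIn

theorem isConnected_identityComponent (H : Subgroup G) :
    IsConnected (identityComponent H : Set G) :=
  ⟨⟨1, one_mem _⟩, isPreconnected_identityComponent H⟩

theorem le_identityComponent {K H : Subgroup G} (hK : IsPreconnected (K : Set G)) (h : K ≤ H) :
    K ≤ identityComponent H := by
  rw [← SetLike.coe_subset_coe, coe_identityComponent]
  exact hK.subset_connectedComponentIn K.one_mem h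

theorem identityComponent_mono {K H : Subgroup G} (h : K ≤ H) :
    identityComponent K ≤ identityComponent H :=
  le_identityComponent (isPreconnected_identityComponent K) ((identityComponent_le K).trans h)

theorem isClosed_identityComponent {H : Subgroup G} (hH : IsClosed (H : Set G)) :
    IsClosed (identityComponent H : Set G) := by
  have : IsClosed (((↑) : H → G) '' connectedComponent (1 : H)) :=
    hH.isClosedEmbedding_subtypeVal.isClosedMap _ isClosed_connectedComponent
  exact this

theorem identityComponent_top :
    identityComponent (⊤ : Subgroup G) = Subgroup.connectedComponentOfOne G := by
  apply SetLike.coe_injective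
  rw [coe_identityComponent, Subgroup.coe_top, connectedComponentIn_univ]
  rfl

theorem identityComponent_map_subtype (M : Subgroup G) (K : Subgroup M) :
    identityComponent (K.map M.subtype) = (identityComponent K).map M.subtype := by
  have hcoe (L : Subgroup M) : ((L.map M.subtype : Subgroup G) : Set G) = ((↑) : M → G) '' L := rfl
  apply le_antisymm
  · have h : ((identityComponent (K.map M.subtype)).subgroupOf M).map M.subtype =
        identityComponent (K.map M.subtype) := by
      rw [Subgroup.subgroupOf_map_subtype, inf_eq_left]
      exact (identityComponent_le _).trans (Subgroup.map_subtype_le K)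
    rw [← h]
    refine Subgroup.map_mono (le_identityComponent ?_ ?_)
    · rw [← IsInducing.subtypeVal.isPreconnected_image]
      change IsPreconnected (((identityComponent _).subgroupOf M).map M.subtype : Set G)
      rw [h]
      exact isPreconnected_identityComponent _
    · intro x hx
      obtain ⟨y, hy, hyx⟩ := identityComponent_le _ hx
      exact Subtype.ext hyx ▸ hy
  · refine le_identityComponent ?_ (Subgroup.map_mono (identityComponent_le K))
    rw [hcoe, IsInducing.subtypeVal.isPreconnected_image]
    exact isPreconnected_identityComponent K

/-- A connected subgroup lies in every subgroup containing its elements near the identity. -/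
theorem le_of_isPreconnected {K C : Subgroup G} (hK : IsPreconnected (K : Set G)) {V : Set G}
    (hV : V ∈ 𝓝 (1 : G)) (h : ∀ x ∈ K, x ∈ V → x ∈ C) : K ≤ C := by
  have : PreconnectedSpace K := isPreconnected_iff_preconnectedSpace.1 hK
  have ho : IsOpen (C.subgroupOf K : Set K) := by
    refine Subgroup.isOpen_of_mem_nhds (g := 1) _ ?_
    filter_upwards [continuous_subtype_val.continuousAt.preimage_mem_nhds (x := (1 : K)) hV]
      with x hx using h x x.2 hx
  have hu := IsClopen.eq_univ ⟨Subgroup.isClosed_of_isOpen _ ho, ho⟩ ⟨1, one_mem _⟩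
  intro x hx
  exact (hu ▸ mem_univ _ : (⟨x, hx⟩ : K) ∈ (C.subgroupOf K : Set K))

end IdentityComponent

/-! ### Closed subgroups: openness of the identity component, dimension -/

namespace LocalLog

variable {G E : Type*} [Group G] [TopologicalSpace G] [IsTopologicalGroup G]
  [NormedAddCommGroup E] (Φ : LocalLog G E)

/-- Elements near the identity outside a closed subgroup `A` can be moved by `A` to almost minimal
distance from `A`. -/
theorem exists_almost_minimal {A B : Subgroup G} (hA : IsClosed (A : Set G)) (hAB : A ≤ B)
    (hB : ∀ V ∈ 𝓝 (1 : G), ∃ x ∈ B, x ∈ V ∧ x ∉ A) {δ : ℝ} (hδ : 0 < δ) :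
    ∃ c ∈ B, c ∈ Φ.dom ∧ 0 < ‖Φ.toFun c‖ ∧ ‖Φ.toFun c‖ < δ ∧
      ∀ a ∈ A, a⁻¹ * c ∈ Φ.dom → ‖Φ.toFun c‖ / 2 ≤ ‖Φ.toFun (a⁻¹ * c)‖ := by
  obtain ⟨b, hbB, ⟨hbd, hbδ⟩, hbA⟩ := hB _ (Φ.ball_mem_nhds hδ)
  set S : Set ℝ := {x | ∃ a ∈ A, a⁻¹ * b ∈ Φ.dom ∧ ‖Φ.toFun (a⁻¹ * b)‖ = x}
  have hbS : ‖Φ.toFun b‖ ∈ S := ⟨1, A.one_mem, by simpa using hbd, by simp⟩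
  have hS0 : BddBelow S := ⟨0, by rintro _ ⟨a, -, -, rfl⟩; exact norm_nonneg _⟩
  have hm : 0 < sInf S := by
    have hn : {x : G | x⁻¹ * b ∉ A} ∈ 𝓝 (1 : G) := by
      have hc : Continuous fun x : G => x⁻¹ * b := by fun_prop
      exact (hA.isOpen_compl.preimage hc).mem_nhds (by simpa using hbA)
    have hn' : {x : G | b * x⁻¹ ∉ A} ∈ 𝓝 (1 : G) := by
      have hc : Continuous fun x : G => b * x⁻¹ := by fun_prop
      exact (hA.isOpen_compl.preimage hc).mem_nhds (by simpa using hbA)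
    obtain ⟨r, hr, h⟩ := Φ.basis _ hn'
    refine hr.trans_le (le_csInf ⟨_, hbS⟩ ?_)
    rintro _ ⟨a, ha, had, rfl⟩
    by_contra! hlt
    exact h _ had hlt (by simpa [mul_inv_rev] using ha)
  -- The infimum need not be attained; an element below twice its value suffices, whence the factor
  -- 1/2 in the conclusion.
  obtain ⟨x, ⟨a, ha, had, rfl⟩, hx1, hx2⟩ : ∃ x ∈ S, x < 2 * sInf S ∧ x < δ := by
    obtain ⟨x, hxS, hx⟩ := exists_lt_of_csInf_lt ⟨_, hbS⟩
      (show sInf S < min (2 * sInf S) δ from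
        lt_min (by linarith) ((csInf_le hS0 hbS).trans_lt hbδ))
    exact ⟨x, hxS, lt_min_iff.1 hx⟩
  refine ⟨a⁻¹ * b, B.mul_mem (B.inv_mem (hAB ha)) hbB, had,
    hm.trans_le (csInf_le hS0 ⟨a, ha, had, rfl⟩), hx2, fun a' ha' had' => ?_⟩
  have : sInf S ≤ ‖Φ.toFun (a'⁻¹ * (a⁻¹ * b))‖ :=
    csInf_le hS0 ⟨a * a', A.mul_mem ha ha', by simpa [mul_assoc] using had', by simp [mul_assoc]⟩
  linarith

variable [NormedSpace ℝ E]

theorem IsLimitDirection.mem_tangent_identityComponent [CompactSpace G] [T2Space G] {Φ : LocalLog G E} {A : Subgroup G}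
    (hA : IsClosed (A : Set G)) {v : E} (hv : Φ.IsLimitDirection A v) :
    v ∈ Φ.tangent (identityComponent A) := by
  have : CompactSpace A := isCompact_iff_compactSpace.1 hA.isCompact
  have hv' : (Φ.restrict A).IsLimitDirection ⊤ v := fun ε hε δ hδ => by
    obtain ⟨a, ha, had, h⟩ := hv ε hε δ hδ
    exact ⟨⟨a, ha⟩, trivial, had, h⟩
  intro ε hε
  obtain ⟨δ, hδ, h⟩ := (Φ.restrict A).exists_mem_connectedComponent hv' hε
  refine ⟨δ, hδ, fun t ht htδ => ?_⟩
  obtain ⟨a, ha, had, hat⟩ := h t ht htδ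
  exact ⟨a, ⟨a, ha, rfl⟩, had, hat⟩

/-- Otherwise almost minimal representatives c of cosets outside A tend to 1, and their directions
accumulate at a unit vector v tangent to A. Some a ∈ A then agrees with c to first order, so a⁻¹ * c
is less than half as long as c, against almost minimality. -/
theorem exists_nhds_of_tangent [FiniteDimensional ℝ E] {A B : Subgroup G}
    (hA : IsClosed (A : Set G)) (hAB : A ≤ B)
    (h : ∀ v, Φ.IsLimitDirection B v → v ∈ Φ.tangent A) :
    ∃ V ∈ 𝓝 (1 : G), ∀ x ∈ B, x ∈ V → x ∈ A := by
  by_contra! hB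
  have hex (n : ℕ) := Φ.exists_almost_minimal hA hAB hB (δ := 1 / ((n : ℝ) + 1)) (by positivity)
  choose c hcB hcd hc0 hcn hcmin using hex
  have : ProperSpace E := FiniteDimensional.proper ℝ E
  obtain ⟨v, hv, σ, hσ, hlim⟩ := (isCompact_sphere (0 : E) 1).tendsto_subseq
    (x := fun n => ‖Φ.toFun (c n)‖⁻¹ • Φ.toFun (c n)) (fun n => by
      rw [mem_sphere_zero_iff_norm, norm_smul, norm_inv, norm_norm, inv_mul_cancel₀ (hc0 n).ne'])
  have hv1 : ‖v‖ = 1 := mem_sphere_zero_iff_norm.1 hv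
  have hdir : ∀ ε > 0, ∀ δ > 0, ∃ n, ‖Φ.toFun (c n)‖ < δ ∧
      ‖Φ.toFun (c n) - ‖Φ.toFun (c n)‖ • v‖ ≤ ε * ‖Φ.toFun (c n)‖ := by
    intro ε hε δ hδ
    have h1 := (Metric.tendsto_nhds.1 hlim ε hε)
    have h2 := (tendsto_one_div_add_atTop_nhds_zero_nat (𝕜 := ℝ)).comp hσ.tendsto_atTop
    obtain ⟨n, hn1, hn2⟩ := (h1.and (h2.eventually (gt_mem_nhds hδ))).exists
    refine ⟨σ n, (hcn _).trans hn2, ?_⟩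
    have h3 : Φ.toFun (c (σ n)) - ‖Φ.toFun (c (σ n))‖ • v =
        ‖Φ.toFun (c (σ n))‖ • (‖Φ.toFun (c (σ n))‖⁻¹ • Φ.toFun (c (σ n)) - v) := by
      rw [smul_sub, smul_inv_smul₀ (hc0 _).ne']
    rw [h3, norm_smul, norm_norm, mul_comm]
    rw [dist_eq_norm] at hn1
    exact mul_le_mul_of_nonneg_right hn1.le (norm_nonneg _)
  have hvA : v ∈ Φ.tangent A := h v fun ε hε δ hδ => by
    obtain ⟨n, hn1, hn2⟩ := hdir ε hε δ hδ
    exact ⟨c n, hcB n, hcd n, _, hc0 n, hn1, hn2⟩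
  obtain ⟨δ, hδ, hA'⟩ := hvA (1 / 16) (by norm_num)
  obtain ⟨r₁, hr₁, hm⟩ := Φ.mul (1 / 16) (by norm_num)
  obtain ⟨r₂, hr₂, hi⟩ := Φ.inv (ε := min (1 / 16) r₁) (by positivity)
  obtain ⟨n, hn1, hn2⟩ := hdir (1 / 16) (by norm_num) (min (min δ r₁) (r₂ / 2)) (by positivity)
  simp only [lt_min_iff] at hn1
  obtain ⟨⟨hnδ, hnr1⟩, hnr2⟩ := hn1
  have ht0 := hc0 n
  set t := ‖Φ.toFun (c n)‖ with htdef
  obtain ⟨a, haA, had, ha⟩ := hA' t ht0 hnδ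
  have hna : ‖Φ.toFun a‖ ≤ 17 / 16 * t := by
    have := norm_le_norm_sub_add (Φ.toFun a) (t • v)
    rw [norm_smul, hv1, Real.norm_of_nonneg ht0.le] at this
    linarith
  obtain ⟨hid, hin, hie⟩ := hi a had (by linarith)
  rw [lt_min_iff] at hin
  obtain ⟨hd, he⟩ := hm _ hid _ (hcd n) hin.2 hnr1
  have hmin := hcmin n a haA hd
  have hie' : ‖Φ.toFun a⁻¹ + Φ.toFun a‖ ≤ 1 / 16 * ‖Φ.toFun a‖ :=
    hie.trans (mul_le_mul_of_nonneg_right (min_le_left _ _) (norm_nonneg _))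
  have : Φ.toFun (a⁻¹ * c n) = (Φ.toFun (a⁻¹ * c n) - Φ.toFun a⁻¹ - Φ.toFun (c n)) +
      (Φ.toFun a⁻¹ + Φ.toFun a) + ((Φ.toFun (c n) - t • v) - (Φ.toFun a - t • v)) := by abel
  rw [this] at hmin
  have hfin := hmin.trans (norm_add₃_le)
  have hsub := norm_sub_le (Φ.toFun (c n) - t • v) (Φ.toFun a - t • v)
  rw [← htdef] at he hfin
  linarith

/-- The identity component of a closed subgroup is open in it. -/
theorem exists_nhds_identityComponent (Φ : LocalLog G E) [FiniteDimensional ℝ E]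
    [CompactSpace G] [T2Space G] {A : Subgroup G} (hA : IsClosed (A : Set G)) :
    ∃ V ∈ 𝓝 (1 : G), ∀ x ∈ A, x ∈ V → x ∈ identityComponent A :=
  Φ.exists_nhds_of_tangent (isClosed_identityComponent hA) (identityComponent_le A)
    fun _ hv => hv.mem_tangent_identityComponent hA

theorem tangent_lt_of_lt [FiniteDimensional ℝ E] [CompactSpace G] [T2Space G] {A B : Subgroup G} (hA : IsClosed (A : Set G))
    (hB : IsClosed (B : Set G)) (hBc : IsPreconnected (B : Set G)) (h : A < B) :
    Φ.tangent A < Φ.tangent B := by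
  refine (Φ.tangent_mono h.le).lt_of_not_ge fun hle => h.not_ge ?_
  obtain ⟨V, hV, hVA⟩ := Φ.exists_nhds_of_tangent hA h.le fun v hv =>
    hle (Φ.tangent_mono (identityComponent_le B) (hv.mem_tangent_identityComponent hB))
  exact le_of_isPreconnected hBc hV hVA

/-- The dimension of a subgroup. -/
noncomputable def dim (A : Subgroup G) : ℕ := Module.finrank ℝ (Φ.tangent (identityComponent A))

theorem dim_le [FiniteDimensional ℝ E] (A : Subgroup G) : Φ.dim A ≤ Module.finrank ℝ E := Submodule.finrank_le _

theorem dim_lt [FiniteDimensional ℝ E] [CompactSpace G] [T2Space G] {A B : Subgroup G}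
    (hA : IsClosed (A : Set G)) (hB : IsClosed (B : Set G))
    (h : identityComponent A < identityComponent B) : Φ.dim A < Φ.dim B :=
  Submodule.finrank_lt_finrank_of_lt <|
    Φ.tangent_lt_of_lt (isClosed_identityComponent hA) (isClosed_identityComponent hB)
      (isPreconnected_identityComponent B) h

end LocalLog

/-! ### Lie primitivity and the abelian part, seen in the ambient group -/

section Relative

variable {G : Type*} [Group G] [TopologicalSpace G] [IsTopologicalGroup G]

theorem conj_mem_identityComponent_of_conj {H : Subgroup G} {g : G}
    (hg : ∀ x ∈ H, g * x * g⁻¹ ∈ H) {x : G} (hx : x ∈ identityComponent H) :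
    g * x * g⁻¹ ∈ identityComponent H := by
  have h : (identityComponent H).map (MulAut.conj g).toMonoidHom ≤ identityComponent H := by
    refine le_identityComponent ?_ ?_
    · refine (isPreconnected_identityComponent H).image (fun y => g * y * g⁻¹) ?_
      fun_prop
    · rintro _ ⟨y, hy, rfl⟩
      exact hg y (identityComponent_le H hy)
  exact h ⟨x, hx, rfl⟩

/-- The abelian part of a subgroup, as a subgroup of the ambient group. -/
def relAbelianPart (M : Subgroup G) : Subgroup G := (abelianPart M).map M.subtype

theorem mem_relAbelianPart {M : Subgroup G} {x : G} : x ∈ relAbelianPart M ↔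
    x ∈ M ∧ x ∈ Subgroup.centralizer
      (⁅identityComponent M, identityComponent M⁆ : Subgroup G) := by
  have h : (⁅identityComponent M, identityComponent M⁆ : Subgroup G) =
      (⁅Subgroup.connectedComponentOfOne M, Subgroup.connectedComponentOfOne M⁆ :
        Subgroup M).map M.subtype := (Subgroup.map_commutator _ _ _).symm
  rw [h]
  constructor
  · rintro ⟨y, hy, rfl⟩
    refine ⟨y.2, Subgroup.mem_centralizer_iff.2 ?_⟩
    rintro _ ⟨z, hz, rfl⟩
    exact congrArg Subtype.val (Subgroup.mem_centralizer_iff.1 hy z hz)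
  · rintro ⟨hxM, hx⟩
    refine ⟨⟨x, hxM⟩, Subgroup.mem_centralizer_iff.2 fun z hz => Subtype.ext ?_, rfl⟩
    exact Subgroup.mem_centralizer_iff.1 hx _ ⟨z, hz, rfl⟩

theorem conj_mem_relAbelianPart {M : Subgroup G} {g x : G} (hg : g ∈ M)
    (hx : x ∈ relAbelianPart M) : g * x * g⁻¹ ∈ relAbelianPart M := by
  obtain ⟨y, hy, rfl⟩ := hx
  exact ⟨⟨g, hg⟩ * y * ⟨g, hg⟩⁻¹, abelianPart_normal.conj_mem y hy _, rfl⟩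

/-- Criterion for Lie primitivity in terms of subgroups of the ambient group. -/
theorem isLiePrimitive_subgroupOf {L M : Subgroup G} (hLM : L ≤ M) (hL : IsClosed (L : Set G))
    (hM : IsClosed (M : Set G)) (hA : identityComponent (relAbelianPart M) ≤ L)
    (h : ∀ K : Subgroup G, IsClosed (K : Set G) → L ≤ K → K ≤ M →
      identityComponent K ≠ identityComponent M → identityComponent L < identityComponent K →
      (∀ x ∈ identityComponent L, ∀ k ∈ identityComponent K,
        k * x * k⁻¹ ∈ identityComponent L) → False) :
    IsLiePrimitive (L.subgroupOf M) := by
  have hinj := Subgroup.map_injective M.subtype_injective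
  have hLM' : (L.subgroupOf M).map M.subtype = L := by
    rw [Subgroup.subgroupOf_map_subtype, inf_eq_left.2 hLM]
  refine ⟨hL.preimage continuous_subtype_val, ?_, ?_⟩
  · intro x hx
    refine hA ?_
    rw [relAbelianPart, identityComponent_map_subtype]
    exact ⟨x, hx, rfl⟩
  · rintro ⟨K, hK, hLK, hne, hlt, hn⟩
    have hLc : identityComponent L = (identityComponent (L.subgroupOf M)).map M.subtype := by
      rw [← identityComponent_map_subtype, hLM']
    refine h (K.map M.subtype) (hM.isClosedEmbedding_subtypeVal.isClosedMap _ hK)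
      (hLM' ▸ Subgroup.map_mono hLK) (Subgroup.map_subtype_le K) ?_ ?_ ?_
    · rw [identityComponent_map_subtype]
      exact fun he => hne (hinj he)
    · rw [hLc, identityComponent_map_subtype]
      exact (Subgroup.map_lt_map_iff_of_injective M.subtype_injective).2 hlt
    · rw [hLc, identityComponent_map_subtype]
      rw [Subgroup.normal_subgroupOf_iff hlt.le] at hn
      rintro _ ⟨x, hx, rfl⟩ _ ⟨k, hk, rfl⟩
      exact ⟨k * x * k⁻¹, hn x k hx hk, rfl⟩

theorem isClosed_abelianPart [T2Space G] : IsClosed (abelianPart G : Set G) :=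
  Set.isClosed_centralizer _

end Relative

/-! ### Rigidity, and the quotient by the abelian part -/

namespace LocalLog

variable {G E : Type*} [Group G] [TopologicalSpace G] [IsTopologicalGroup G] [CompactSpace G]
  [T2Space G] [NormedAddCommGroup E] [NormedSpace ℝ E]

open scoped commutatorElement

/-- If `x` is close to the identity and `d ↦ ⁅x, d⁆` is a homomorphism on `T`, it is trivial. -/
theorem exists_nhds_mem_centralizer (Φ : LocalLog G E) : ∃ V ∈ 𝓝 (1 : G), ∀ x ∈ V,
    ∀ T : Subgroup G, (∀ c ∈ T, ∀ d ∈ T, Commute c ⁅x, d⁆) → x ∈ Subgroup.centralizer T := by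
  obtain ⟨U, hU, hNSS⟩ := Φ.exists_nhds_no_subgroup
  obtain ⟨U', hU'U, hU', h1⟩ := mem_nhds_iff.1 hU
  have ho : IsOpen {p : G × G | ⁅p.1, p.2⁆ ∈ U'} := by
    have hc : Continuous fun p : G × G => p.1 * p.2 * p.1⁻¹ * p.2⁻¹ := by fun_prop
    exact hU'.preimage hc
  obtain ⟨u, w, hu, -, hu1, hw, huw⟩ := generalized_tube_lemma
    (isCompact_singleton (x := (1 : G))) (isCompact_univ (X := G)) ho (by
      rintro ⟨x, y⟩ ⟨rfl, -⟩
      simpa using h1)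
  refine ⟨u, hu.mem_nhds (hu1 rfl), fun x hx T hT => ?_⟩
  -- The image of c ↦ ⁅x, c⁆ is a subgroup inside U, uniformly in T by compactness of G, hence
  -- trivial as there are no small subgroups.
  let f : T →* G :=
    { toFun := fun c => ⁅x, (c : G)⁆
      map_one' := by simp
      map_mul' := fun c d => by
        have := (hT c c.2 d d.2).eq
        calc ⁅x, ((c * d : T) : G)⁆ = x * c * x⁻¹ * ⁅x, (d : G)⁆ * (c : G)⁻¹ := by
              simp [commutatorElement_def]; group
          _ = x * c * x⁻¹ * (c : G)⁻¹ * (c * ⁅x, (d : G)⁆) * (c : G)⁻¹ := by group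
          _ = ⁅x, (c : G)⁆ * ⁅x, (d : G)⁆ := by
              rw [this, commutatorElement_def x (c : G)]; group }
  have hf : f.range = ⊥ := hNSS _ (by
    rintro _ ⟨c, rfl⟩
    exact hU'U (huw (a := (x, (c : G))) ⟨hx, hw trivial⟩))
  refine Subgroup.mem_centralizer_iff.2 fun c hc => ?_
  have : ⁅x, c⁆ = 1 := by
    have : f ⟨c, hc⟩ ∈ f.range := ⟨_, rfl⟩
    rwa [hf] at this
  exact (commutatorElement_eq_one_iff_mul_comm.1 this).symm

/-- Rigidity: a connected group normalizing a commutative subgroup centralizes it. -/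
theorem le_centralizer_of_isPreconnected (Φ : LocalLog G E) {K T : Subgroup G}
    (hK : IsPreconnected (K : Set G)) (hT : ∀ c ∈ T, ∀ d ∈ T, Commute c d)
    (hKT : ∀ k ∈ K, ∀ c ∈ T, k * c * k⁻¹ ∈ T) : K ≤ Subgroup.centralizer T := by
  obtain ⟨V, hV, h⟩ := Φ.exists_nhds_mem_centralizer
  exact le_of_isPreconnected hK hV fun x hx hxV => h x hxV T fun c hc d hd =>
    hT c hc _ (T.mul_mem (hKT x hx d hd) (T.inv_mem hd))

/-- Commutators of elements of (A_M)₀ lie in [M₀, M₀], which A_M centralizes; rigidity makes (A_M)₀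
commutative. It is normalized by M₀, so rigidity applies again. -/
theorem identityComponent_le_centralizer_relAbelianPart (Φ : LocalLog G E) (M : Subgroup G) :
    identityComponent M ≤
      Subgroup.centralizer (identityComponent (relAbelianPart M) : Subgroup G) := by
  have hle : relAbelianPart M ≤ M := Subgroup.map_subtype_le _
  obtain ⟨V, hV, h⟩ := Φ.exists_nhds_mem_centralizer
  have hcomm : identityComponent (relAbelianPart M) ≤
      Subgroup.centralizer (identityComponent (relAbelianPart M) : Subgroup G) := by
    refine le_of_isPreconnected (isPreconnected_identityComponent _) hV fun x hx hxV =>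
      h x hxV _ fun c hc d hd => ?_
    have hc' := (mem_relAbelianPart.1 (identityComponent_le _ hc)).2
    exact (Subgroup.mem_centralizer_iff.1 hc' _ (Subgroup.commutator_mem_commutator
      (identityComponent_mono hle hx) (identityComponent_mono hle hd))).symm
  refine Φ.le_centralizer_of_isPreconnected (isPreconnected_identityComponent M)
    (fun c hc d hd => (Subgroup.mem_centralizer_iff.1 (hcomm hc) d hd).symm) ?_
  intro k hk c hc
  exact conj_mem_identityComponent_of_conj
    (fun x hx => conj_mem_relAbelianPart (identityComponent_le M hk) hx) hc

variable [FiniteDimensional ℝ E]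

/-- The identity component of the preimage is open in it and the quotient map is open, so its image
contains a neighbourhood of 1 in K. -/
theorem identityComponent_quotient (Φ : LocalLog G E) {N : Subgroup G} [N.Normal]
    {K : Subgroup (G ⧸ N)} (hK : IsClosed (K : Set (G ⧸ N))) :
    identityComponent K =
      (identityComponent (K.comap (QuotientGroup.mk' N))).map (QuotientGroup.mk' N) := by
  have hc : Continuous (QuotientGroup.mk' N) := QuotientGroup.continuous_mk
  obtain ⟨V, hV, h⟩ := Φ.exists_nhds_identityComponent (A := K.comap (QuotientGroup.mk' N))
    (hK.preimage hc)
  apply le_antisymm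
  · refine le_of_isPreconnected (isPreconnected_identityComponent K)
      (QuotientGroup.isOpenMap_coe.image_mem_nhds hV) ?_
    rintro _ hx ⟨v, hv, rfl⟩
    exact ⟨v, h v (identityComponent_le K hx) hv, rfl⟩
  · refine le_identityComponent
      ((isPreconnected_identityComponent _).image _ hc.continuousOn) ?_
    rintro _ ⟨x, hx, rfl⟩
    exact identityComponent_le (K.comap (QuotientGroup.mk' N)) hx

/-- If x represents an element of the abelian part of the quotient and d ∈ [G₀, G₀], then ⁅x, d⁆ ∈
A_G commutes with [G₀, G₀]. Rigidity puts x in A_G when x is near 1. -/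
theorem identityComponent_abelianPart_quotient (Φ : LocalLog G E) :
    identityComponent (abelianPart (G ⧸ abelianPart G)) = ⊥ := by
  have : IsClosed (abelianPart G : Set G) := isClosed_abelianPart
  rw [Φ.identityComponent_quotient isClosed_abelianPart, Subgroup.map_eq_bot_iff,
    QuotientGroup.ker_mk']
  obtain ⟨V, hV, h⟩ := Φ.exists_nhds_mem_centralizer
  refine le_of_isPreconnected (isPreconnected_identityComponent _) hV fun x hx hxV =>
    h x hxV _ fun c hc d hd => ?_
  have hx' := identityComponent_le _ hx
  have hle : (Subgroup.connectedComponentOfOne G).map (QuotientGroup.mk' (abelianPart G)) ≤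
      Subgroup.connectedComponentOfOne (G ⧸ abelianPart G) := by
    rw [← identityComponent_top, ← identityComponent_top]
    exact le_identityComponent ((isPreconnected_identityComponent _).image _
      QuotientGroup.continuous_mk.continuousOn) le_top
  have hd' := Subgroup.commutator_mono hle hle
    (Subgroup.map_commutator _ _ (QuotientGroup.mk' (abelianPart G)) ▸
      Subgroup.mem_map_of_mem (QuotientGroup.mk' (abelianPart G)) hd)
  have hxd := (Subgroup.mem_centralizer_iff.1 hx' _ hd').symm
  have hker : ⁅x, d⁆ ∈ abelianPart G := by
    rw [← QuotientGroup.ker_mk' (abelianPart G), MonoidHom.mem_ker, map_commutatorElement]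
    exact commutatorElement_eq_one_iff_mul_comm.2 hxd
  exact Subgroup.mem_centralizer_iff.1 hker c hc

/-- In the quotient the first two conditions of Lie primitivity are automatic, so failure yields an
obstructing subgroup; K is its preimage. Its identity component is nontrivial modulo A_G because it
strictly contains another. -/
theorem exists_of_not_isLiePrimitive_map (Φ : LocalLog G E) {S : Subgroup G}
    (hS : IsClosed (S : Set G))
    (h : ¬ IsLiePrimitive (S.map (QuotientGroup.mk' (abelianPart G)))) :
    ∃ K : Subgroup G, IsClosed (K : Set G) ∧ S ≤ K ∧ abelianPart G ≤ K ∧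
      identityComponent K ≠ Subgroup.connectedComponentOfOne G ∧
      ¬ identityComponent K ≤ abelianPart G := by
  have : IsClosed (abelianPart G : Set G) := isClosed_abelianPart
  have hc : Continuous (QuotientGroup.mk' (abelianPart G)) := QuotientGroup.continuous_mk
  have hS' : IsClosed (S.map (QuotientGroup.mk' (abelianPart G)) : Set (G ⧸ abelianPart G)) :=
    (hS.isCompact.image hc).isClosed
  by_contra! hcon
  refine h ⟨hS', by rw [Φ.identityComponent_abelianPart_quotient]; exact bot_le, ?_⟩
  rintro ⟨K, hK, hSK, hne, hlt, -⟩
  have hK0 := Φ.identityComponent_quotient hK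
  have hle := hcon (K.comap (QuotientGroup.mk' (abelianPart G))) (hK.preimage hc)
    (Subgroup.map_le_iff_le_comap.1 hSK)
    ((QuotientGroup.ker_mk' (abelianPart G)).symm.le.trans (MonoidHom.ker_le_comap _ _))
    (fun he => hne ?_)
  · have hbot := (Subgroup.map_eq_bot_iff _).2
      (hle.trans (QuotientGroup.ker_mk' (abelianPart G)).symm.le)
    rw [hK0, hbot] at hlt
    exact not_lt_bot hlt
  · rw [hK0, he, ← identityComponent_top, ← identityComponent_top,
      Φ.identityComponent_quotient (K := ⊤) isClosed_univ, Subgroup.comap_top]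

end LocalLog

/-! ### Tori and full rank -/

section

variable {G : Type*} [Group G]

theorem isMulCommutative_iff_commute {T : Subgroup G} :
    IsMulCommutative T ↔ ∀ x ∈ T, ∀ y ∈ T, Commute x y :=
  ⟨fun h x hx y hy => congrArg Subtype.val (h.is_comm.comm (⟨x, hx⟩ : T) ⟨y, hy⟩),
    fun h => ⟨⟨fun x y => Subtype.ext (h x x.2 y y.2)⟩⟩⟩

theorem commutator_self_eq_bot_iff {T : Subgroup G} :
    (⁅T, T⁆ : Subgroup G) = ⊥ ↔ ∀ x ∈ T, ∀ y ∈ T, Commute x y := by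
  rw [Subgroup.commutator_eq_bot_iff_le_centralizer]
  exact ⟨fun h x hx y hy => (Subgroup.mem_centralizer_iff.1 (h hx) y hy).symm,
    fun h x hx => Subgroup.mem_centralizer_iff.2 fun y hy => h y hy x hx⟩

variable [TopologicalSpace G]

/-- A torus: a closed connected abelian subgroup. -/
def IsTorus (T : Subgroup G) : Prop :=
  IsClosed (T : Set G) ∧ IsConnected (T : Set G) ∧ IsMulCommutative T

theorem IsTorus.commute {T : Subgroup G} (hT : IsTorus T) : ∀ x ∈ T, ∀ y ∈ T, Commute x y :=
  isMulCommutative_iff_commute.1 hT.2.2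

variable [IsTopologicalGroup G]

theorem isClosed_normalizer {T : Subgroup G} (hT : IsClosed (T : Set G)) :
    IsClosed (Subgroup.normalizer (T : Set G) : Set G) := by
  have h : (Subgroup.normalizer (T : Set G) : Set G) =
      ⋂ t ∈ T, ((fun g : G => g * t * g⁻¹) ⁻¹' T ∩ (fun g : G => g⁻¹ * t * g) ⁻¹' T) := by
    ext g
    simp only [SetLike.mem_coe, Subgroup.mem_normalizer_iff, mem_iInter, mem_inter_iff,
      mem_preimage]
    refine ⟨fun h t ht => ⟨(h t).1 ht, (h _).2 (by simpa [mul_assoc] using ht)⟩,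
      fun h t => ⟨fun ht => (h t ht).1, fun ht => ?_⟩⟩
    simpa [mul_assoc] using (h _ ht).2
  rw [h]
  refine isClosed_biInter fun t _ => IsClosed.inter ?_ ?_
  · exact hT.preimage (by fun_prop)
  · exact hT.preimage (by fun_prop)

theorem IsTorus.sup [CompactSpace G] [T2Space G] {T T' : Subgroup G} (hT : IsTorus T)
    (hT' : IsTorus T') (h : T' ≤ Subgroup.centralizer T) : IsTorus (T' ⊔ T) := by
  have hcoe : ((T' ⊔ T : Subgroup G) : Set G) = (fun p : G × G => p.1 * p.2) '' (T' ×ˢ T) := by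
    rw [Subgroup.coe_mul_of_left_le_normalizer_right _ _
      (h.trans (Subgroup.centralizer_le_normalizer _)), ← Set.image_mul_prod]
  have hc : Continuous fun p : G × G => p.1 * p.2 := continuous_mul
  have hcc {x y : G} (hx : x ∈ T') (hy : y ∈ T) : Commute x y :=
    (Subgroup.mem_centralizer_iff.1 (h hx) y hy).symm
  refine ⟨?_, ?_, isMulCommutative_iff_commute.2 ?_⟩
  · rw [hcoe]
    exact ((hT'.1.isCompact.prod hT.1.isCompact).image hc).isClosed
  · rw [hcoe]
    exact (hT'.2.1.prod hT.2.1).image _ hc.continuousOn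
  · intro x hx y hy
    rw [← SetLike.mem_coe, hcoe] at hx hy
    obtain ⟨⟨a, b⟩, ⟨ha, hb⟩, rfl⟩ := hx
    obtain ⟨⟨c, d⟩, ⟨hc, hd⟩, rfl⟩ := hy
    exact ((hT'.commute a ha c hc).mul_right (hcc ha hd)).mul_left
      (((hcc hc hb).symm).mul_right (hT.commute b hb d hd))

/-- Every maximal torus of `M` is a Cartan subgroup of the ambient group. -/
def HasFullRank (M : Subgroup G) : Prop :=
  ∀ T : Subgroup G, Maximal (fun T => IsTorus T ∧ T ≤ M) T → IsCartanSubgroup T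

theorem HasFullRank.isCartanSubgroup_identityComponent {M : Subgroup G} (h : HasFullRank M)
    (hM : IsClosed (M : Set G))
    (hc : (⁅identityComponent M, identityComponent M⁆ : Subgroup G) = ⊥) :
    IsCartanSubgroup (identityComponent M) :=
  h _ ⟨⟨⟨isClosed_identityComponent hM, isConnected_identityComponent M,
    isMulCommutative_iff_commute.2 (commutator_self_eq_bot_iff.1 hc)⟩, identityComponent_le M⟩,
    fun _ hT _ => le_identityComponent hT.1.2.1.isPreconnected hT.2⟩

/-- A maximal torus T' of the normalizer centralizes T, hence contains it, since T'T is again a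
torus. Any torus of M above T' then centralizes T and lies in the normalizer, so T' is already
maximal in M. -/
theorem HasFullRank.inf_normalizer [CompactSpace G] [T2Space G] {M T : Subgroup G}
    (h : HasFullRank M) (hT : IsTorus T)
    (hTN : T ≤ identityComponent (M ⊓ Subgroup.normalizer (T : Set G)))
    (hN : identityComponent (M ⊓ Subgroup.normalizer (T : Set G)) ≤ Subgroup.centralizer T) :
    HasFullRank (M ⊓ Subgroup.normalizer (T : Set G)) := by
  intro T' hT'
  have hT'c : T' ≤ Subgroup.centralizer T :=
    (le_identityComponent hT'.prop.1.2.1.isPreconnected hT'.prop.2).trans hN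
  have hTT' : T ≤ T' := le_sup_right.trans (hT'.le_of_ge
    ⟨hT.sup hT'.prop.1 hT'c, sup_le hT'.prop.2 (hTN.trans (identityComponent_le _))⟩ le_sup_left)
  refine h T' ⟨⟨hT'.prop.1, hT'.prop.2.trans inf_le_left⟩, fun T'' hT'' hle => ?_⟩
  refine hT'.le_of_ge ⟨hT''.1, le_inf hT''.2 ?_⟩ hle
  refine le_trans ?_ (Subgroup.centralizer_le_normalizer _)
  exact fun x hx => Subgroup.mem_centralizer_iff.2 fun y hy =>
    hT''.1.commute y (hle (hTT' hy)) x hx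

theorem IsQuasiPrimitive.trans_isLiePrimitive {M L : Subgroup G} (hM : IsQuasiPrimitive M)
    (hLM : L ≤ M) (h : IsLiePrimitive (L.subgroupOf M)) : IsQuasiPrimitive L :=
  Relation.ReflTransGen.tail hM ⟨hLM, h⟩

end

/-! ### The two descents -/

namespace LocalLog

variable {G E : Type*} [Group G] [TopologicalSpace G] [IsTopologicalGroup G] [CompactSpace G]
  [T2Space G] [NormedAddCommGroup E] [NormedSpace ℝ E]

theorem identityComponent_inf_normalizer_le_centralizer (Φ : LocalLog G E) {M T : Subgroup G}
    (hT : IsTorus T) :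
    identityComponent (M ⊓ Subgroup.normalizer (T : Set G)) ≤ Subgroup.centralizer T :=
  Φ.le_centralizer_of_isPreconnected (isPreconnected_identityComponent _) hT.commute
    fun _ hk c hc => (Subgroup.mem_normalizer_iff.1 (identityComponent_le _ hk).2 c).1 hc

/-- The normalizer of a torus of `M` is Lie primitive in `M`. -/
theorem isLiePrimitive_inf_normalizer (Φ : LocalLog G E) {M T : Subgroup G}
    (hM : IsClosed (M : Set G)) (hT : IsTorus T) (hTM : T ≤ identityComponent M) :
    IsLiePrimitive ((M ⊓ Subgroup.normalizer (T : Set G)).subgroupOf M) := by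
  set N := M ⊓ Subgroup.normalizer (T : Set G)
  have hNT : identityComponent N ≤ Subgroup.centralizer T :=
    Φ.identityComponent_inf_normalizer_le_centralizer hT
  have hTN : T ≤ identityComponent N := le_identityComponent hT.2.1.isPreconnected
    (le_inf (hTM.trans (identityComponent_le M)) Subgroup.le_normalizer)
  have hcent {K : Subgroup G} (hKM : K ≤ M) (hK : K ≤ Subgroup.centralizer T) : K ≤ N :=
    le_inf hKM (hK.trans (Subgroup.centralizer_le_normalizer _))
  refine isLiePrimitive_subgroupOf inf_le_left (hM.inter (isClosed_normalizer hT.1)) hM ?_ ?_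
  · refine hcent ((identityComponent_le _).trans (Subgroup.map_subtype_le _)) ?_
    rw [Subgroup.le_centralizer_iff]
    exact hTM.trans (Φ.identityComponent_le_centralizer_relAbelianPart M)
  · intro K _ _ hKM _ hlt hn
    -- Z is the centre of N₀. Normality of N₀ in K₀ makes K₀ normalize Z, hence centralize Z ⊇ T by
    -- rigidity; so K₀ ⊆ N, against N₀ < K₀.
    set Z : Subgroup G :=
      identityComponent N ⊓ Subgroup.centralizer (identityComponent N : Subgroup G)
    have hKZ : identityComponent K ≤ Subgroup.centralizer Z := by
      refine Φ.le_centralizer_of_isPreconnected (isPreconnected_identityComponent K)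
        (fun c hc d hd => Subgroup.mem_centralizer_iff.1 hd.2 c hc.1) fun k hk c hc => ?_
      refine ⟨hn c hc.1 k hk, Subgroup.mem_centralizer_iff.2 fun y hy => ?_⟩
      have h1 : k⁻¹ * y * k ∈ identityComponent N := by
        simpa using hn y hy k⁻¹ (inv_mem hk)
      have h2 := Subgroup.mem_centralizer_iff.1 hc.2 _ h1
      calc y * (k * c * k⁻¹) = k * ((k⁻¹ * y * k) * c) * k⁻¹ := by group
        _ = k * c * k⁻¹ * y := by rw [h2]; group
    have hTZ : T ≤ Z := le_inf hTN ((Subgroup.le_centralizer_iff).1 hNT)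
    exact hlt.not_ge (le_identityComponent (isPreconnected_identityComponent K)
      (hcent ((identityComponent_le K).trans hKM)
        (hKZ.trans (Subgroup.centralizer_le hTZ))))

variable [FiniteDimensional ℝ E]

theorem exists_isLiePrimitive_of_not_isLiePrimitive_image (Φ : LocalLog G E) {S H : Subgroup G}
    (hS : IsClosed (S : Set G)) (hH : IsClosed (H : Set G)) (hSH : S ≤ H)
    (h : ¬ IsLiePrimitive (imageModAbelianPart S H)) :
    ∃ L : Subgroup G, IsClosed (L : Set G) ∧ S ≤ L ∧ L ≤ H ∧ IsLiePrimitive (L.subgroupOf H) ∧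
      identityComponent L < identityComponent H ∧
      ¬ identityComponent L ≤ relAbelianPart H := by
  have : CompactSpace H := isCompact_iff_compactSpace.1 hH.isCompact
  obtain ⟨K, hK, hSK, hAK, hK1, hK2⟩ := (Φ.restrict H).exists_of_not_isLiePrimitive_map
    (S := S.subgroupOf H) (hS.preimage continuous_subtype_val) h
  set P : Subgroup G → Prop := fun L => IsClosed (L : Set G) ∧ K.map H.subtype ≤ L ∧ L ≤ H ∧
    identityComponent L ≠ identityComponent H
  have hP : P (K.map H.subtype) := by
    refine ⟨hH.isClosedEmbedding_subtypeVal.isClosedMap _ hK, le_rfl,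
      Subgroup.map_subtype_le K, ?_⟩
    rw [identityComponent_map_subtype]
    exact fun he => hK1 (Subgroup.map_injective H.subtype_injective he)
  -- Least codimension means greatest dimension: a subgroup violating Lie primitivity of L would
  -- satisfy `P` with larger dimension.
  obtain ⟨L, ⟨hL, hKL, hLH, hne⟩, hmax⟩ :=
    (InvImage.wf (fun L => Module.finrank ℝ E - Φ.dim L) wellFounded_lt).has_min
      {L | P L} ⟨_, hP⟩
  have hAL : relAbelianPart H ≤ L := (Subgroup.map_mono hAK).trans hKL
  refine ⟨L, hL, ?_, hLH, ?_, (identityComponent_mono hLH).lt_of_ne hne, fun hle => hK2 ?_⟩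
  · rw [← inf_eq_left.2 hSH, ← Subgroup.subgroupOf_map_subtype]
    exact (Subgroup.map_mono hSK).trans hKL
  · refine isLiePrimitive_subgroupOf hLH hL hH ((identityComponent_le _).trans hAL) ?_
    intro K' hK' hLK' hK'H hne' hlt _
    refine hmax K' ⟨hK', hKL.trans hLK', hK'H, hne'⟩ ?_
    have h1 := Φ.dim_lt hL hK' hlt
    have h2 := Φ.dim_le K'
    change _ - _ < _ - _
    omega
  · have := (identityComponent_mono hKL).trans hle
    rw [identityComponent_map_subtype] at this
    exact (Subgroup.map_le_map_iff_of_injective H.subtype_injective).1 this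

theorem exists_isQuasiPrimitive (Φ : LocalLog G E)
    (hG : Subgroup.connectedComponentOfOne G ≠ ⊥) (S : Subgroup G) (hS : IsClosed (S : Set G)) :
    ∃ H : Subgroup G, IsClosed (H : Set G) ∧ IsQuasiPrimitive H ∧ identityComponent H ≠ ⊥ ∧
      S ≤ H ∧ (IsCartanSubgroup (identityComponent H) ∨
        (⁅identityComponent H, identityComponent H⁆ ≠ ⊥ ∧
          IsLiePrimitive (imageModAbelianPart S H))) := by
  obtain ⟨M, ⟨hM, hMq, hM1, hSM, hMr⟩, hMmin⟩ := (InvImage.wf Φ.dim wellFounded_lt).has_min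
    {M | IsClosed (M : Set G) ∧ IsQuasiPrimitive M ∧ identityComponent M ≠ ⊥ ∧ S ≤ M ∧
      HasFullRank M}
    ⟨⊤, isClosed_univ, Relation.ReflTransGen.refl, by rwa [identityComponent_top], le_top,
      fun T hT => ⟨hT.prop.1, fun T' hT' => hT.le_of_ge ⟨hT', le_top⟩⟩⟩
  by_cases hMc : (⁅identityComponent M, identityComponent M⁆ : Subgroup G) = ⊥
  · exact ⟨M, hM, hMq, hM1, hSM, Or.inl (hMr.isCartanSubgroup_identityComponent hM hMc)⟩
  obtain ⟨H, ⟨hH, hHq, hHM, hSH, hHc⟩, hHmin⟩ := (InvImage.wf Φ.dim wellFounded_lt).has_min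
    {H | IsClosed (H : Set G) ∧ IsQuasiPrimitive H ∧ H ≤ M ∧ S ≤ H ∧
      (⁅identityComponent H, identityComponent H⁆ : Subgroup G) ≠ ⊥}
    ⟨M, hM, hMq, le_rfl, hSM, hMc⟩
  by_cases hp : IsLiePrimitive (imageModAbelianPart S H)
  · refine ⟨H, hH, hHq, fun hb => hHc ?_, hSH, Or.inr ⟨hHc, hp⟩⟩
    rw [hb, Subgroup.commutator_bot_left]
  exfalso
  obtain ⟨L, hL, hSL, hLH, hLp, hlt, hLA⟩ :=
    Φ.exists_isLiePrimitive_of_not_isLiePrimitive_image hS hH hSH hp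
  set T := identityComponent L with hTdef
  have hTc : (⁅T, T⁆ : Subgroup G) = ⊥ := by
    by_contra hc
    exact hHmin L ⟨hL, hHq.trans_isLiePrimitive hLH hLp, hLH.trans hHM, hSL, hc⟩
      (Φ.dim_lt hL hH hlt)
  have hT : IsTorus T := ⟨isClosed_identityComponent hL, isConnected_identityComponent L,
    isMulCommutative_iff_commute.2 (commutator_self_eq_bot_iff.1 hTc)⟩
  have hTM : T ≤ identityComponent M := identityComponent_mono (hLH.trans hHM)
  have hTN : T ≤ identityComponent (M ⊓ Subgroup.normalizer (T : Set G)) :=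
    le_identityComponent hT.2.1.isPreconnected
      (le_inf (hTM.trans (identityComponent_le M)) Subgroup.le_normalizer)
  have hNT := Φ.identityComponent_inf_normalizer_le_centralizer (M := M) hT
  have hN : IsClosed ((M ⊓ Subgroup.normalizer (T : Set G) : Subgroup G) : Set G) :=
    hM.inter (isClosed_normalizer hT.1)
  refine hMmin (M ⊓ Subgroup.normalizer (T : Set G)) ⟨hN,
    hMq.trans_isLiePrimitive inf_le_left (Φ.isLiePrimitive_inf_normalizer hM hT hTM), ?_,
    le_inf hSM ?_, hMr.inf_normalizer hT hTN hNT⟩ (Φ.dim_lt hN hM ?_)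
  · intro hb
    rw [hb] at hTN
    exact hLA (hTN.trans bot_le)
  · intro s hs
    have h1 {g x : G} (hg : g ∈ L) (hx : x ∈ T) : g * x * g⁻¹ ∈ T :=
      conj_mem_identityComponent_of_conj
        (fun y hy => L.mul_mem (L.mul_mem hg hy) (L.inv_mem hg)) hx
    refine Subgroup.mem_normalizer_iff.2 fun x => ⟨h1 (hSL hs), fun hx => ?_⟩
    simpa [mul_assoc] using h1 (L.inv_mem (hSL hs)) hx
  -- If N₀ = M₀, then M₀ centralizes T, in particular [H₀, H₀] does, which forces T into A_H.
  · refine (identityComponent_mono inf_le_left).lt_of_ne fun he => hLA fun x hx => ?_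
    rw [he] at hNT
    refine mem_relAbelianPart.2 ⟨hLH (identityComponent_le L hx), ?_⟩
    refine Subgroup.mem_centralizer_iff.2 fun y hy => ?_
    have hyM : y ∈ identityComponent M := identityComponent_mono hHM
      (Subgroup.commutator_le_self _ hy)
    exact (Subgroup.mem_centralizer_iff.1 (hNT hyM) x hx).symm

end LocalLog
end CompactLie

theorem theorem1p1
    {E : Type*} [NormedAddCommGroup E] [NormedSpace ℝ E] [FiniteDimensional ℝ E]
    {G : Type*} [Group G] [TopologicalSpace G] [IsTopologicalGroup G]
    [ChartedSpace E G] [LieGroup 𝓘(ℝ, E) ∞ G] [CompactSpace G] [T2Space G]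
    (hG : Subgroup.connectedComponentOfOne G ≠ ⊥)
    (S : Subgroup G) (hS : IsClosed (S : Set G)) :
    ∃ H : Subgroup G,
      IsClosed (H : Set G) ∧
      CompactLie.IsQuasiPrimitive H ∧
      CompactLie.identityComponent H ≠ ⊥ ∧
      S ≤ H ∧
      (CompactLie.IsCartanSubgroup (CompactLie.identityComponent H) ∨
        (⁅CompactLie.identityComponent H, CompactLie.identityComponent H⁆ ≠ ⊥ ∧
          CompactLie.IsLiePrimitive (CompactLie.imageModAbelianPart S H))) := by
  obtain ⟨Φ⟩ := CompactLie.nonempty_localLog (E := E) G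
  exact Φ.exists_isQuasiPrimitive hG S hS
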